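/- Let $q\ge 1$, $\boldsymbol\mu\in\mathbb R^q$, $\lambda>0$ and let $\boldsymbol\Gamma$ be a positive definite $q\times q$ matrix. Let $\boldsymbol w$ be a multivariate Laplacian source on $\mathbb R^q$, i.e. a random vector with density $$P_{\boldsymbol w}(x)=\frac{1}{\sqrt{\det\boldsymbol\Gamma}}\,\frac{1}{(2\pi)^{q/2}}\,\frac{2}{\lambda}\,\frac{K_{q/2-1}\big(\sqrt{\tfrac{2}{\lambda}y(x)}\big)}{\big(\sqrt{\tfrac{\lambda}{2}y(x)}\big)^{q/2-1}},\qquad y(x)=(x-\boldsymbol\mu)^{\mathsf T}\boldsymbol\Gamma^{-1}(x-\boldsymbol\mu),$$ where $K_\nu$ is the modified Bessel function of the second kind (the usual normalization is $\det\boldsymbol\Gamma=1$). This is a probability density, and its differential entropy $h(\boldsymbol w)=-\int_{\mathbb R^q}P_{\boldsymbol w}\log_2P_{\boldsymbol w}$ is a convergent integral. Consider the distortion $d(\boldsymbol w,\hat{\boldsymbol w})=\|\boldsymbol w-\hat{\boldsymbol w}\|$ (Euclidean norm), and let $$R(D)=\inf\big\{I(\boldsymbol w;\hat{\boldsymbol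 w}) : P_{\hat{\boldsymbol w}|\boldsymbol w}\ \text{with}\ \mathbb E\|\boldsymbol w-\hat{\boldsymbol w}\|\le D\big\}$$ be the rate-distortion function, with mutual information in bits. Then for every $D>0$ $$R(D)\ \ge\ h(\boldsymbol w)+q\log_2\!\Big(\frac{q}{\sqrt\pi\,\mathrm e\,D}\Big)+\log_2\!\Big(\frac{\Gamma(q/2)}{2\Gamma(q)}\Big).$$ The same bound holds for the operational rate-distortion function, the infimum of all rates $R$ such that $(R,D)$ is achievable. Here $(R,D)$ is achievable if there are block codes for $n$ i.i.d. copies of the source ($n=1,2,\dots$) with at most $2^{nR}$ codewords and with expected distortion $\mathbb E\big[\tfrac1n\sum_{i=1}^n\|\boldsymbol w_i-\hat{\boldsymbol w}_i\|\big]$ of limit superior at most $D$. Consequently, let a model have $q$ on-device and $s$ on-server parameters, $q+s\ge1$, stored with $b\ge 0$ bits each, and let its whole parameter vector $\boldsymbol w\in\mathbb R^{q+s}$ be a multivariate Laplacian source as above (in dimension $q+s$). Let $\rho,\tilde\rho\in[0,1]$ be the pruning ratios (fractions of remaining on-device and on-server parameters). Then at the pruned model rate $R=(\rho q+\tilde\rho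 s)b$ the distortion-rate function $D(R)$, the infimum of all $D$ such that $(R,D)$ is achievable, satisfies $$D(R)\ \ge\ \hat D(\rho,\tilde\rho):=\frac{q+s}{\sqrt\pi\,\mathrm e}\;2^{-\frac{(\rho q+\tilde\rho s)b-h(\boldsymbol w)}{q+s}}\Big(\frac{\Gamma(\frac{q+s}{2})}{2\Gamma(q+s)}\Big)^{\frac1{q+s}},$$ and the same bound holds for the inverse $\inf\{D : R(D)\le R\}$ of the rate-distortion function $R(\cdot)$ displayed above. -/

import Mathlib

open MeasureTheory ProbabilityTheory
open scoped ENNReal Matrix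

namespace RateDist

noncomputable section

/-- Modified Bessel function of the second kind `K_ν(x)` of real order `ν`, for `x > 0`, through
the integral representation `K_ν(x) = ½ (x/2)^ν ∫₀^∞ exp(-t - x²/(4t)) t^(-ν-1) dt`. -/
def besselK (ν x : ℝ) : ℝ :=
  1 / 2 * (x / 2) ^ ν * ∫ t in Set.Ioi (0 : ℝ), Real.exp (-t - x ^ 2 / (4 * t)) * t ^ (-ν - 1)

/-- The quadratic form `(x - m)ᵀ Γ⁻¹ (x - m)`. -/
def quadForm {q : ℕ} (m : EuclideanSpace ℝ (Fin q)) (Γ : Matrix (Fin q) (Fin q) ℝ)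
    (x : EuclideanSpace ℝ (Fin q)) : ℝ :=
  WithLp.ofLp (x - m) ⬝ᵥ (Γ⁻¹ *ᵥ WithLp.ofLp (x - m))

/-- Density of the multivariate Laplacian distribution on `ℝ^q` with mean `m`, scale parameter
`lam` and positive definite shape matrix `Γ`. The factor `1 / √(det Γ)` is `1` under the usual
normalization `det Γ = 1`; it makes the total mass `1` for every positive definite `Γ`. -/
def mvLaplacePDF {q : ℕ} (m : EuclideanSpace ℝ (Fin q)) (lam : ℝ) (Γ : Matrix (Fin q) (Fin q) ℝ)
    (x : EuclideanSpace ℝ (Fin q)) : ℝ :=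
  1 / √Γ.det * (1 / (2 * Real.pi) ^ ((q : ℝ) / 2)) * (2 / lam) *
    (besselK ((q : ℝ) / 2 - 1) √(2 / lam * quadForm m Γ x) /
      √(lam / 2 * quadForm m Γ x) ^ ((q : ℝ) / 2 - 1))

/-- The multivariate Laplacian distribution: the law on `ℝ^q` with density `mvLaplacePDF`. -/
def mvLaplace {q : ℕ} (m : EuclideanSpace ℝ (Fin q)) (lam : ℝ) (Γ : Matrix (Fin q) (Fin q) ℝ) :
    Measure (EuclideanSpace ℝ (Fin q)) :=
  volume.withDensity fun x => ENNReal.ofReal (mvLaplacePDF m lam Γ x)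

/-- Differential entropy, in bits, of a random vector with density `p`. -/
def differentialEntropy {q : ℕ} (p : EuclideanSpace ℝ (Fin q) → ℝ) : ℝ :=
  -∫ x, p x * Real.logb 2 (p x)

/-- Mutual information, in bits, of a pair of random vectors with joint law `J`: the
Kullback-Leibler divergence of `J` from the product of its marginals. -/
def mutualInformation {q : ℕ}
    (J : Measure (EuclideanSpace ℝ (Fin q) × EuclideanSpace ℝ (Fin q))) : ℝ≥0∞ :=
  InformationTheory.klDiv J (J.fst.prod J.snd) / ENNReal.ofReal (Real.log 2)

/-- The rate-distortion function `R(D)` (in bits) of a source with law `P`: the infimum of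
`I(w; ŵ)` over all conditional laws of `ŵ` given `w` with `E ‖w - ŵ‖ ≤ D`. -/
def rateDistortion {q : ℕ} (P : Measure (EuclideanSpace ℝ (Fin q))) (D : ℝ≥0∞) : ℝ≥0∞ :=
  ⨅ (κ : Kernel (EuclideanSpace ℝ (Fin q)) (EuclideanSpace ℝ (Fin q))) (_ : IsMarkovKernel κ)
    (_ : ∫⁻ x, ‖x.1 - x.2‖ₑ ∂(P ⊗ₘ κ) ≤ D), mutualInformation (P ⊗ₘ κ)

/-- The inverse of the rate-distortion function: the smallest distortion `D` with `R(D) ≤ R`. -/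
def rateDistortionInv {q : ℕ} (P : Measure (EuclideanSpace ℝ (Fin q))) (R : ℝ) : ℝ≥0∞ :=
  sInf {D | rateDistortion P D ≤ ENNReal.ofReal R}

/-- Expected per-letter distortion `E[(1/n) ∑ ‖wᵢ - ŵᵢ‖]` of the block code `(e, g)` with `M`
codewords on `n` independent samples of the source `P`. -/
def blockDistortion {q : ℕ} (P : Measure (EuclideanSpace ℝ (Fin q))) {n M : ℕ}
    (e : (Fin n → EuclideanSpace ℝ (Fin q)) → Fin M)
    (g : Fin M → Fin n → EuclideanSpace ℝ (Fin q)) : ℝ≥0∞ :=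
  ∫⁻ w, (∑ i, ‖w i - g (e w) i‖ₑ) / n ∂(Measure.pi fun _ : Fin n => P)

/-- `(R, D)` is achievable: there are encoders and decoders for all block lengths `n`, with at most
`2^(nR)` codewords, whose asymptotic expected distortion is at most `D`. -/
def Achievable {q : ℕ} (P : Measure (EuclideanSpace ℝ (Fin q))) (R : ℝ) (D : ℝ≥0∞) : Prop :=
  ∃ (M : ℕ → ℕ) (e : ∀ n, (Fin n → EuclideanSpace ℝ (Fin q)) → Fin (M n))
    (g : ∀ n, Fin (M n) → Fin n → EuclideanSpace ℝ (Fin q)),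
    (∀ n, Measurable (e n)) ∧ (∀ n, (M n : ℝ) ≤ 2 ^ ((n : ℝ) * R)) ∧
      Filter.limsup (fun n => blockDistortion P (e n) (g n)) Filter.atTop ≤ D

/-- The operational rate-distortion function: infimum of the rates `R` with `(R, D)` achievable. -/
def codingRate {q : ℕ} (P : Measure (EuclideanSpace ℝ (Fin q))) (D : ℝ≥0∞) : EReal :=
  ⨅ (R : ℝ) (_ : Achievable P R D), (R : EReal)

/-- The distortion-rate function `D(R)`: infimum of the distortions `D` with `(R, D)` achievable. -/
def distortionRate {q : ℕ} (P : Measure (EuclideanSpace ℝ (Fin q))) (R : ℝ) : ℝ≥0∞ :=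
  sInf {D | Achievable P R D}

/-- The explicit lower bound for the rate (in bits) in dimension `q`, for a source of differential
entropy `h` and distortion `D`. -/
def rateLowerBound (q : ℕ) (h D : ℝ) : ℝ :=
  h + q * Real.logb 2 (q / (√Real.pi * Real.exp 1 * D)) +
    Real.logb 2 (Real.Gamma ((q : ℝ) / 2) / (2 * Real.Gamma q))

/-- The explicit lower bound `D̂(ρ, ρ')` for the distortion, for on-device and on-server models with
`q` and `s` parameters, `b` bits per parameter and a parameter vector of entropy `h`. -/
def distortionLowerBound (q s : ℕ) (b h ρ ρ' : ℝ) : ℝ :=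
  ((q : ℝ) + s) / (√Real.pi * Real.exp 1) *
    (2 : ℝ) ^ (-(((ρ * q + ρ' * s) * b - h) / ((q : ℝ) + s))) *
    (Real.Gamma (((q : ℝ) + s) / 2) / (2 * Real.Gamma ((q : ℝ) + s))) ^ (1 / ((q : ℝ) + s))

end

end RateDist

/-!
A lower bound for the rate of a source with density `p` on `ℝ^q` comes from the dual function
`f (x, y) = -log (p x) - s ‖x - y‖` with slope `s = q / D`. The density cancels in
`∫ exp (f (x, y)) p x dx`, which is therefore at most `Z = ∫ exp (-s ‖x‖) dx` for every `y`
(`lintegral_exp_neg_log_sub_le`), and `Z` is explicit because the volume of the unit ball is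
(`lintegral_exp_neg_mul_norm_sub`).

* For a test channel with joint law `J`, the Donsker–Varadhan inequality
  (`ofReal_integral_sub_log_le_klDiv`) gives `I ≥ ∫ f dJ - log Z ≥ h - s D - log Z` in nats, which is
  the asserted bound (`rateLowerBound_le_rateDistortion`, `rateLowerBound_mul_log_two`).
* For a block code with `M` codewords, the exponential of the sum of `f` over the letters is at most
  the sum over all codewords, whose integral is at most `M Z ^ n` by independence. Jensen's
  inequality then gives `n (h - s D - log Z) ≤ log M` directly, without mutual information
  (`dual_bound_of_blockCode`, `rateLowerBound_le_of_achievable`).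

The distortion bounds are the inverse statements (`distortionLowerBound_le`).

That the Laplacian density qualifies rests on the integral representation of the Bessel function,
which makes it the mixture over an exponentially distributed scale `t` of Gaussian densities with
covariance `lam t Γ` (`mvLaplacePDF_eq_integral`, `ofReal_mvLaplacePDF`). Total mass one is Tonelli's
theorem. The entropy integral converges because `|log p|` is bounded by a constant plus a multiple
of the quadratic form plus `q p ^ (1 / q)`: the density has a Gaussian lower bound
(`exists_le_mvLaplacePDF`), second moments (`lintegral_quadForm_mul_mvLaplacePDF_lt_top`), and lies in
`L^(1 + 1/q)` (`lintegral_mvLaplacePDF_mul_rpow_lt_top`).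
-/

namespace RateDist

/-! ### The Donsker–Varadhan inequality -/

/-- One half of the Donsker–Varadhan variational formula. Tilting `ν` by `f` changes `∫ llr μ ν ∂μ`
by `log ∫ eᶠ ∂ν - ∫ f ∂μ`, and the divergence from the tilted measure is nonnegative. -/
theorem ofReal_integral_sub_log_le_klDiv {α : Type*} [MeasurableSpace α] {μ ν : Measure α}
    [IsProbabilityMeasure μ] [IsProbabilityMeasure ν] {f : α → ℝ} (hf : Measurable f)
    (hfμ : Integrable f μ) {Z : ℝ} (hZ : 0 ≤ Z)
    (h : ∫⁻ x, ENNReal.ofReal (Real.exp (f x)) ∂ν ≤ ENNReal.ofReal Z) :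
    ENNReal.ofReal (∫ x, f x ∂μ - Real.log Z) ≤ InformationTheory.klDiv μ ν := by
  by_cases htop : InformationTheory.klDiv μ ν = ∞
  · simp [htop]
  obtain ⟨hac, hint⟩ := InformationTheory.klDiv_ne_top_iff.1 htop
  have hfν : Integrable (fun x => Real.exp (f x)) ν := by
    refine ⟨hf.exp.aestronglyMeasurable, ?_⟩
    rw [hasFiniteIntegral_iff_ofReal (ae_of_all _ fun x => (Real.exp_pos _).le)]
    exact h.trans_lt ENNReal.ofReal_lt_top
  have hpos : 0 < ∫ x, Real.exp (f x) ∂ν := integral_exp_pos hfν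
  have hle : ∫ x, Real.exp (f x) ∂ν ≤ Z := by
    rw [← ENNReal.ofReal_le_ofReal_iff hZ,
      ofReal_integral_eq_lintegral_ofReal hfν (ae_of_all _ fun x => (Real.exp_pos _).le)]
    exact h
  have := isProbabilityMeasure_tilted hfν
  have key := InformationTheory.integral_llr_add_sub_measure_univ_nonneg
    (hac.trans (absolutelyContinuous_tilted hfν)) (integrable_llr_tilted_right hac hfμ hint hfν)
  rw [integral_llr_tilted_right hac hfμ hfν hint] at key
  rw [InformationTheory.klDiv_of_ac_of_integrable hac hint]
  have := Real.log_le_log hpos hle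
  simp only [probReal_univ] at key ⊢
  exact ENNReal.ofReal_le_ofReal (by linarith)

/-- Jensen's inequality for the exponential. -/
theorem integral_le_log_of_lintegral_exp_le {α : Type*} [MeasurableSpace α] {μ : Measure α}
    [IsProbabilityMeasure μ] {f : α → ℝ} (hf : Measurable f)
    (hfμ : Integrable f μ) {Z : ℝ} (hZ : 0 ≤ Z)
    (h : ∫⁻ x, ENNReal.ofReal (Real.exp (f x)) ∂μ ≤ ENNReal.ofReal Z) :
    ∫ x, f x ∂μ ≤ Real.log Z := by
  have := ofReal_integral_sub_log_le_klDiv hf hfμ hZ h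
  rw [InformationTheory.klDiv_self, nonpos_iff_eq_zero, ENNReal.ofReal_eq_zero] at this
  linarith

/-- Tonelli for a product of functions of the coordinates of independent samples. -/
theorem lintegral_pi_prod {α ι : Type*} [MeasurableSpace α] [Fintype ι] (μ : Measure α)
    [IsProbabilityMeasure μ] (F : ι → α → ℝ≥0∞) (hF : ∀ i, Measurable (F i)) :
    ∫⁻ w, ∏ i, F i (w i) ∂(Measure.pi fun _ : ι => μ) = ∏ i, ∫⁻ x, F i x ∂μ := by
  refine (lintegral_prod_eq_prod_lintegral_of_indepFun Finset.univ (fun i (w : ι → α) => F i (w i))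
    (iIndepFun_pi fun i => (hF i).aemeasurable)
    fun i => (hF i).comp (measurable_pi_apply i)).trans ?_
  exact Finset.prod_congr rfl fun i _ =>
    (measurePreserving_eval (fun _ : ι => μ) i).lintegral_comp (hF i)

/-! ### The normalizing constant of the distortion kernel -/

/-- The total mass of `x ↦ exp (-s ‖x‖)` on `ℝ^q`. -/
noncomputable def expNormMass (q : ℕ) (s : ℝ) : ℝ :=
  (s ^ q)⁻¹ * (√Real.pi ^ q * (2 * Real.Gamma q / Real.Gamma ((q : ℝ) / 2)))

theorem expNormMass_pos {q : ℕ} (hq : 0 < q) {s : ℝ} (hs : 0 < s) : 0 < expNormMass q s := by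
  have hq' : (0 : ℝ) < q := Nat.cast_pos.2 hq
  have h1 := Real.Gamma_pos_of_pos hq'
  have h2 := Real.Gamma_pos_of_pos (half_pos hq')
  have := Real.pi_pos
  unfold expNormMass
  positivity

/-- The volume of the unit ball determines the mass of `exp (-‖x‖)`. -/
theorem integral_exp_neg_norm {q : ℕ} (hq : 0 < q) :
    ∫ x : EuclideanSpace ℝ (Fin q), Real.exp (-‖x‖) =
      √Real.pi ^ q * (2 * Real.Gamma q / Real.Gamma ((q : ℝ) / 2)) := by
  have : Nonempty (Fin q) := ⟨⟨0, hq⟩⟩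
  have hq' : (0 : ℝ) < q := Nat.cast_pos.2 hq
  have h1 := Real.Gamma_pos_of_pos hq'
  have h2 := Real.Gamma_pos_of_pos (half_pos hq')
  have hpi := Real.pi_pos
  have h := measure_unitBall_eq_integral_div_gamma
    (volume : Measure (EuclideanSpace ℝ (Fin q))) zero_lt_one
  rw [EuclideanSpace.volume_ball] at h
  simp only [ENNReal.ofReal_one, one_pow, one_mul, Fintype.card_fin, Real.rpow_one,
    finrank_euclideanSpace, div_one] at h
  have hI : 0 ≤ ∫ x : EuclideanSpace ℝ (Fin q), Real.exp (-‖x‖) :=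
    integral_nonneg fun x => (Real.exp_pos _).le
  rw [Real.Gamma_add_one hq'.ne', Real.Gamma_add_one (half_pos hq').ne',
    ENNReal.ofReal_eq_ofReal_iff (by positivity) (by positivity)] at h
  rw [eq_div_iff (by positivity)] at h
  rw [← h]
  field_simp

theorem lintegral_exp_neg_mul_norm_sub {q : ℕ} (hq : 0 < q) {s : ℝ} (hs : 0 < s)
    (y : EuclideanSpace ℝ (Fin q)) :
    ∫⁻ x : EuclideanSpace ℝ (Fin q), ENNReal.ofReal (Real.exp (-(s * ‖x - y‖))) =
      ENNReal.ofReal (expNormMass q s) := by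
  have hI : ∫ x : EuclideanSpace ℝ (Fin q), Real.exp (-(s * ‖x‖)) = expNormMass q s := by
    have := Measure.integral_comp_smul (volume : Measure (EuclideanSpace ℝ (Fin q)))
      (fun x => Real.exp (-‖x‖)) s
    rw [integral_exp_neg_norm hq, finrank_euclideanSpace, Fintype.card_fin,
      abs_of_pos (by positivity)] at this
    simpa [norm_smul, abs_of_pos hs, expNormMass] using this
  have hint : Integrable fun x : EuclideanSpace ℝ (Fin q) => Real.exp (-(s * ‖x‖)) :=
    Integrable.of_integral_ne_zero (hI ▸ (expNormMass_pos hq hs).ne')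
  rw [lintegral_sub_right_eq_self (μ := volume)
    (fun x : EuclideanSpace ℝ (Fin q) => ENNReal.ofReal (Real.exp (-(s * ‖x‖)))) y, ← hI,
    ofReal_integral_eq_lintegral_ofReal hint (ae_of_all _ fun x => (Real.exp_pos _).le)]

/-- At the slope `s = q / D`, which makes the dual bound largest, the dual bound is the explicit
one. -/
theorem rateLowerBound_mul_log_two {q : ℕ} (hq : 0 < q) (h : ℝ) {D : ℝ} (hD : 0 < D) :
    rateLowerBound q h D * Real.log 2 =
      h * Real.log 2 - Real.log (expNormMass q (q / D)) - q / D * D := by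
  have hq' : (0 : ℝ) < q := Nat.cast_pos.2 hq
  have h1 := Real.Gamma_pos_of_pos hq'
  have h2 := Real.Gamma_pos_of_pos (half_pos hq')
  have hpi := Real.pi_pos
  have hl : Real.log 2 ≠ 0 := (Real.log_pos one_lt_two).ne'
  unfold rateLowerBound expNormMass Real.logb
  rw [Real.log_mul (by positivity) (by positivity), Real.log_mul (by positivity) (by positivity),
    Real.log_inv, Real.log_pow, Real.log_pow, Real.log_div (by positivity) (by positivity),
    Real.log_div (by positivity) (by positivity), Real.log_div (by positivity) (by positivity),
    Real.log_div (by positivity) (by positivity), Real.log_mul (by positivity) (by positivity),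
    Real.log_mul (by positivity) (by positivity), Real.log_exp]
  field_simp
  ring

/-! ### The Shannon lower bound for a source with a density -/

section Source

variable {q : ℕ} {p : EuclideanSpace ℝ (Fin q) → ℝ}

/-- The dual feasibility condition: the density cancels against `exp (-log p)`. Where `p` vanishes
the source has no mass. -/
theorem lintegral_exp_neg_log_sub_le (hq : 0 < q) (hp : Measurable p) (hp0 : ∀ x, 0 ≤ p x)
    {s : ℝ} (hs : 0 < s) (y : EuclideanSpace ℝ (Fin q)) :
    ∫⁻ x, ENNReal.ofReal (Real.exp (-Real.log (p x) - s * ‖x - y‖))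
        ∂(volume.withDensity fun x => ENNReal.ofReal (p x)) ≤
      ENNReal.ofReal (expNormMass q s) := by
  rw [← lintegral_exp_neg_mul_norm_sub hq hs y,
    lintegral_withDensity_eq_lintegral_mul _ hp.ennreal_ofReal (by fun_prop)]
  refine lintegral_mono fun x => ?_
  rw [Pi.mul_apply, ← ENNReal.ofReal_mul (hp0 x)]
  refine ENNReal.ofReal_le_ofReal ?_
  rcases (hp0 x).eq_or_lt with h0 | h0
  · rw [← h0, zero_mul]
    exact (Real.exp_pos _).le
  · rw [sub_eq_add_neg, Real.exp_add, Real.exp_neg, Real.exp_log h0, mul_inv_cancel_left₀ h0.ne']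

theorem integrable_log_withDensity (hp : Measurable p) (hp0 : ∀ x, 0 ≤ p x)
    (hint : Integrable fun x => p x * Real.logb 2 (p x)) :
    Integrable (fun x => Real.log (p x)) (volume.withDensity fun x => ENNReal.ofReal (p x)) := by
  rw [integrable_withDensity_iff_integrable_smul' hp.ennreal_ofReal (by simp)]
  refine (hint.mul_const (Real.log 2)).congr (ae_of_all _ fun x => ?_)
  have hl : Real.log 2 ≠ 0 := (Real.log_pos one_lt_two).ne'
  simp only [ENNReal.toReal_ofReal (hp0 x), smul_eq_mul, Real.logb]
  field_simp

theorem integral_neg_log_withDensity (hp : Measurable p) (hp0 : ∀ x, 0 ≤ p x) :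
    ∫ x, -Real.log (p x) ∂(volume.withDensity fun x => ENNReal.ofReal (p x)) =
      differentialEntropy p * Real.log 2 := by
  have hl : Real.log 2 ≠ 0 := (Real.log_pos one_lt_two).ne'
  rw [integral_neg, integral_withDensity_eq_integral_toReal_smul hp.ennreal_ofReal (by simp),
    differentialEntropy, neg_mul, ← integral_mul_const]
  congr 1
  refine integral_congr_ae (ae_of_all _ fun x => ?_)
  simp only [ENNReal.toReal_ofReal (hp0 x), smul_eq_mul, Real.logb]
  field_simp

variable [IsProbabilityMeasure (volume.withDensity fun x => ENNReal.ofReal (p x))]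

theorem rateLowerBound_le_rateDistortion (hq : 0 < q) (hp : Measurable p) (hp0 : ∀ x, 0 ≤ p x)
    (hint : Integrable fun x => p x * Real.logb 2 (p x)) {D : ℝ} (hD : 0 < D) :
    ENNReal.ofReal (rateLowerBound q (differentialEntropy p) D) ≤
      rateDistortion (volume.withDensity fun x => ENNReal.ofReal (p x)) (ENNReal.ofReal D) := by
  have hq' : (0 : ℝ) < q := Nat.cast_pos.2 hq
  have hl : 0 < Real.log 2 := Real.log_pos one_lt_two
  set P : Measure (EuclideanSpace ℝ (Fin q)) :=
    volume.withDensity fun x => ENNReal.ofReal (p x) with hP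
  refine le_iInf fun κ => le_iInf fun _ => le_iInf fun hd => ?_
  set J := P ⊗ₘ κ with hJ
  have hs : 0 < q / D := div_pos hq' hD
  set s := q / D with hsdef
  have hfst : J.fst = P := Measure.fst_compProd P κ
  have hmeas : Measurable fun z : EuclideanSpace ℝ (Fin q) × EuclideanSpace ℝ (Fin q) =>
      -Real.log (p z.1) - s * ‖z.1 - z.2‖ := by fun_prop
  have hmp : MeasurePreserving Prod.fst J P := ⟨measurable_fst, hfst⟩
  have hi1 : Integrable (fun z : EuclideanSpace ℝ (Fin q) × EuclideanSpace ℝ (Fin q) =>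
      -Real.log (p z.1)) J :=
    hmp.integrable_comp_of_integrable (integrable_log_withDensity hp hp0 hint).neg
  have hi2 : Integrable (fun z : EuclideanSpace ℝ (Fin q) × EuclideanSpace ℝ (Fin q) =>
      ‖z.1 - z.2‖) J := by
    refine ⟨by fun_prop, ?_⟩
    simp only [HasFiniteIntegral, enorm_norm]
    exact hd.trans_lt ENNReal.ofReal_lt_top
  have hdist : ∫ z, ‖z.1 - z.2‖ ∂J ≤ D := by
    rw [integral_norm_eq_lintegral_enorm (by fun_prop)]
    exact ENNReal.toReal_le_of_le_ofReal hD.le hd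
  have hent : ∫ z, -Real.log (p z.1) ∂J = differentialEntropy p * Real.log 2 := by
    rw [← integral_neg_log_withDensity hp hp0, ← hP, ← hfst, Measure.fst]
    exact (integral_map measurable_fst.aemeasurable hp.log.neg.aestronglyMeasurable).symm
  have hZ : ∫⁻ z, ENNReal.ofReal (Real.exp (-Real.log (p z.1) - s * ‖z.1 - z.2‖))
      ∂(J.fst.prod J.snd) ≤ ENNReal.ofReal (expNormMass q s) := by
    rw [hfst, lintegral_prod_symm _ (by fun_prop)]
    calc _ ≤ ∫⁻ _, ENNReal.ofReal (expNormMass q s) ∂J.snd :=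
          lintegral_mono fun y => lintegral_exp_neg_log_sub_le hq hp hp0 hs y
      _ = _ := by simp
  have : IsProbabilityMeasure J.fst := by rw [hfst]; infer_instance
  have key := ofReal_integral_sub_log_le_klDiv hmeas (hi1.sub (hi2.const_mul s))
    (expNormMass_pos hq hs).le hZ
  rw [integral_sub hi1 (hi2.const_mul s), integral_const_mul, hent] at key
  rw [mutualInformation, ENNReal.le_div_iff_mul_le (by simp [hl]) (by simp),
    ← ENNReal.ofReal_mul' hl.le, rateLowerBound_mul_log_two hq _ hD]
  refine le_trans (ENNReal.ofReal_le_ofReal ?_) key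
  have := mul_le_mul_of_nonneg_left hdist hs.le
  rw [← hsdef]
  linarith

/-- The converse for a single block code. The exponential of the dual function of the sample and its
reconstruction is at most the sum over all codewords, each of which contributes at most `Z ^ n` by
independence. -/
theorem dual_bound_of_blockCode (hq : 0 < q) (hp : Measurable p) (hp0 : ∀ x, 0 ≤ p x)
    (hint : Integrable fun x => p x * Real.logb 2 (p x)) {s : ℝ} (hs : 0 < s)
    {n M : ℕ} (hn : 0 < n) {e : (Fin n → EuclideanSpace ℝ (Fin q)) → Fin M} (he : Measurable e)
    (g : Fin M → Fin n → EuclideanSpace ℝ (Fin q)) {D : ℝ} (hD : 0 ≤ D)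
    (hd : blockDistortion (volume.withDensity fun x => ENNReal.ofReal (p x)) e g ≤
      ENNReal.ofReal D) :
    n * (differentialEntropy p * Real.log 2 - Real.log (expNormMass q s) - s * D) ≤
      Real.log M := by
  have hn' : (0 : ℝ) < n := Nat.cast_pos.2 hn
  set P : Measure (EuclideanSpace ℝ (Fin q)) :=
    volume.withDensity fun x => ENNReal.ofReal (p x) with hP
  set Pn := Measure.pi fun _ : Fin n => P with hPn
  have hM : 0 < M := (e 0).pos
  have hg : Measurable fun w => g (e w) := (measurable_of_finite g).comp he
  have hge : ∀ i, Measurable fun w => g (e w) i := fun i => (measurable_pi_apply i).comp hg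
  -- integrability and integral of the two parts of the dual function
  have hi1 : ∀ i, Integrable (fun w : Fin n → EuclideanSpace ℝ (Fin q) => -Real.log (p (w i))) Pn :=
    fun i => (measurePreserving_eval (fun _ : Fin n => P) i).integrable_comp_of_integrable
      (integrable_log_withDensity hp hp0 hint).neg
  have hent : ∀ i, ∫ w, -Real.log (p (w i)) ∂Pn = differentialEntropy p * Real.log 2 := by
    intro i
    have hmp := measurePreserving_eval (fun _ : Fin n => P) i
    rw [← integral_neg_log_withDensity hp hp0, ← hP, ← hmp.map_eq]
    exact (integral_map hmp.measurable.aemeasurable hp.log.neg.aestronglyMeasurable).symm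
  have hsum : ∫⁻ w, ∑ i, ‖w i - g (e w) i‖ₑ ∂Pn ≤ ENNReal.ofReal (n * D) := by
    unfold blockDistortion at hd
    simp only [div_eq_mul_inv] at hd
    rw [lintegral_mul_const' _ _ (by simp [hn.ne']), ← div_eq_mul_inv,
      ENNReal.div_le_iff (by simp [hn.ne']) (by simp)] at hd
    refine hd.trans_eq ?_
    rw [mul_comm (n : ℝ), ENNReal.ofReal_mul hD, ENNReal.ofReal_natCast]
  have hdmeas : ∀ i, Measurable fun w : Fin n → EuclideanSpace ℝ (Fin q) => w i - g (e w) i :=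
    fun i => (measurable_pi_apply i).sub (hge i)
  have hnorm : ∀ w : Fin n → EuclideanSpace ℝ (Fin q),
      ENNReal.ofReal (∑ i, ‖w i - g (e w) i‖) = ∑ i, ‖w i - g (e w) i‖ₑ := fun w => by
    rw [ENNReal.ofReal_sum_of_nonneg fun i _ => norm_nonneg _]
    simp
  have hmsum : Measurable fun w : Fin n → EuclideanSpace ℝ (Fin q) => ∑ i, ‖w i - g (e w) i‖ :=
    Finset.measurable_sum _ fun i _ => (hdmeas i).norm
  have h0sum : ∀ w : Fin n → EuclideanSpace ℝ (Fin q), 0 ≤ ∑ i, ‖w i - g (e w) i‖ :=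
    fun w => Finset.sum_nonneg fun i _ => norm_nonneg _
  have hi2 : Integrable (fun w => ∑ i, ‖w i - g (e w) i‖) Pn := by
    refine ⟨hmsum.aestronglyMeasurable, ?_⟩
    rw [hasFiniteIntegral_iff_ofReal (ae_of_all _ h0sum)]
    simp only [hnorm]
    exact hsum.trans_lt ENNReal.ofReal_lt_top
  have hdist : ∫ w, ∑ i, ‖w i - g (e w) i‖ ∂Pn ≤ n * D := by
    rw [integral_eq_lintegral_of_nonneg_ae (ae_of_all _ h0sum) hmsum.aestronglyMeasurable]
    simp only [hnorm]
    exact ENNReal.toReal_le_of_le_ofReal (by positivity) hsum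
  have hi3 : Integrable (fun w : Fin n → EuclideanSpace ℝ (Fin q) =>
      ∑ i, -Real.log (p (w i))) Pn := integrable_finsetSum _ fun i _ => hi1 i
  have hexp : ∫⁻ w, ENNReal.ofReal (Real.exp
      (∑ i, -Real.log (p (w i)) - s * ∑ i, ‖w i - g (e w) i‖)) ∂Pn ≤
      ENNReal.ofReal (M * expNormMass q s ^ n) := by
    calc _ ≤ ∫⁻ w, ∑ k : Fin M, ∏ i,
            ENNReal.ofReal (Real.exp (-Real.log (p (w i)) - s * ‖w i - g k i‖)) ∂Pn := by
          refine lintegral_mono fun w => ?_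
          refine le_trans (le_of_eq ?_) (Finset.single_le_sum (fun k _ => zero_le)
            (Finset.mem_univ (e w)))
          rw [← ENNReal.ofReal_prod_of_nonneg fun i _ => (Real.exp_pos _).le, ← Real.exp_sum,
            Finset.sum_sub_distrib, Finset.mul_sum]
      _ = ∑ k : Fin M, ∏ i, ∫⁻ x,
            ENNReal.ofReal (Real.exp (-Real.log (p x) - s * ‖x - g k i‖)) ∂P := by
          rw [lintegral_finsetSum _ fun k _ => Finset.measurable_prod _ fun i _ => by fun_prop]
          refine Finset.sum_congr rfl fun k _ => ?_
          exact lintegral_pi_prod P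
            (fun i x => ENNReal.ofReal (Real.exp (-Real.log (p x) - s * ‖x - g k i‖)))
            fun i => by fun_prop
      _ ≤ ∑ k : Fin M, ∏ i : Fin n, ENNReal.ofReal (expNormMass q s) :=
          Finset.sum_le_sum fun k _ => Finset.prod_le_prod' fun i _ =>
            lintegral_exp_neg_log_sub_le hq hp hp0 hs _
      _ = _ := by
          rw [ENNReal.ofReal_mul (Nat.cast_nonneg _), ENNReal.ofReal_natCast,
            ENNReal.ofReal_pow (expNormMass_pos hq hs).le]
          simp
  have hZ := expNormMass_pos hq hs
  have hmF : Measurable fun w : Fin n → EuclideanSpace ℝ (Fin q) =>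
      ∑ i, -Real.log (p (w i)) - s * ∑ i, ‖w i - g (e w) i‖ :=
    (Finset.measurable_sum _ fun i _ => by fun_prop).sub (hmsum.const_mul s)
  have key := integral_le_log_of_lintegral_exp_le hmF (hi3.sub (hi2.const_mul s))
    (by positivity) hexp
  rw [integral_sub hi3 (hi2.const_mul s), integral_const_mul, integral_finsetSum _ fun i _ => hi1 i,
    Finset.sum_congr rfl fun i _ => hent i, Real.log_mul (by positivity) (by positivity),
    Real.log_pow] at key
  simp only [Finset.sum_const, Finset.card_univ, Fintype.card_fin, nsmul_eq_mul] at key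
  have := mul_le_mul_of_nonneg_left hdist hs.le
  linarith

/-- The operational converse: codes of rate `R` and asymptotic distortion `D` obey the explicit
bound. The slope is kept fixed while the distortion of the codes tends to `D`. -/
theorem rateLowerBound_le_of_achievable (hq : 0 < q) (hp : Measurable p) (hp0 : ∀ x, 0 ≤ p x)
    (hint : Integrable fun x => p x * Real.logb 2 (p x)) {R D : ℝ} (hD : 0 < D)
    (h : Achievable (volume.withDensity fun x => ENNReal.ofReal (p x)) R (ENNReal.ofReal D)) :
    rateLowerBound q (differentialEntropy p) D ≤ R := by
  have hq' : (0 : ℝ) < q := Nat.cast_pos.2 hq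
  have hl : 0 < Real.log 2 := Real.log_pos one_lt_two
  obtain ⟨M, e, g, he, hM, hlim⟩ := h
  have hs : 0 < q / D := div_pos hq' hD
  have step : ∀ D' : ℝ, D < D' →
      differentialEntropy p * Real.log 2 - Real.log (expNormMass q (q / D)) - q / D * D' ≤
        R * Real.log 2 := by
    intro D' hD'
    have hev := Filter.eventually_lt_of_limsup_lt
      (hlim.trans_lt ((ENNReal.ofReal_lt_ofReal_iff (hD.trans hD')).2 hD'))
    obtain ⟨n, hlt, hn⟩ := (hev.and (Filter.eventually_gt_atTop 0)).exists
    have hn' : (0 : ℝ) < n := Nat.cast_pos.2 hn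
    have key := dual_bound_of_blockCode hq hp hp0 hint hs hn (he n) (g n) (hD.trans hD').le hlt.le
    have hMpos : (0 : ℝ) < M n := Nat.cast_pos.2 (e n 0).pos
    have hlog := Real.log_le_log hMpos (hM n)
    rw [Real.log_rpow two_pos] at hlog
    refine le_of_mul_le_mul_left ?_ hn'
    linarith
  have h2 : differentialEntropy p * Real.log 2 - Real.log (expNormMass q (q / D)) - q / D * D ≤
      R * Real.log 2 := by
    refine le_of_forall_pos_le_add fun ε hε => ?_
    have := step (D + ε / (q / D)) (lt_add_of_pos_right _ (div_pos hε hs))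
    rw [mul_add, mul_div_cancel₀ _ hs.ne'] at this
    linarith
  rw [← rateLowerBound_mul_log_two hq _ hD] at h2
  exact le_of_mul_le_mul_right h2 hl

end Source

/-! ### The exponential mixing law -/

/-- The standard exponential law on `(0, ∞)`. -/
noncomputable def expLaw : Measure ℝ :=
  (volume.restrict (Set.Ioi 0)).withDensity fun t => ENNReal.ofReal (Real.exp (-t))

theorem lintegral_expLaw {F : ℝ → ℝ≥0∞} (hF : Measurable F) :
    ∫⁻ t, F t ∂expLaw = ∫⁻ t in Set.Ioi 0, ENNReal.ofReal (Real.exp (-t)) * F t :=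
  lintegral_withDensity_eq_lintegral_mul _ (by fun_prop) hF

instance : IsProbabilityMeasure expLaw := by
  constructor
  rw [← lintegral_one, lintegral_expLaw measurable_const]
  simp only [mul_one]
  rw [← ofReal_integral_eq_lintegral_ofReal (integrableOn_exp_neg_Ioi 0)
    (ae_of_all _ fun x => (Real.exp_pos _).le), integral_exp_neg_Ioi_zero, ENNReal.ofReal_one]

theorem ae_expLaw_pos : ∀ᵐ t ∂expLaw, 0 < t :=
  (withDensity_absolutelyContinuous _ _).ae_le (ae_restrict_mem measurableSet_Ioi)

/-- The moments of the exponential law are values of the Gamma integral. -/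
theorem lintegral_rpow_expLaw_lt_top {s : ℝ} (hs : 0 < s) :
    ∫⁻ t, ENNReal.ofReal (t ^ (s - 1)) ∂expLaw < ∞ := by
  rw [lintegral_expLaw (by fun_prop)]
  have h := (Real.GammaIntegral_convergent hs).2
  rw [hasFiniteIntegral_iff_ofReal] at h
  · refine lt_of_le_of_lt (le_of_eq ?_) h
    exact lintegral_congr fun t => (ENNReal.ofReal_mul (Real.exp_pos _).le).symm
  · filter_upwards [ae_restrict_mem measurableSet_Ioi] with t ht
    exact mul_nonneg (Real.exp_pos _).le (Real.rpow_nonneg (le_of_lt ht) _)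

theorem expLaw_Icc_pos : 0 < expLaw (Set.Icc 1 2) := by
  rw [expLaw, withDensity_apply _ measurableSet_Icc, Measure.restrict_restrict measurableSet_Icc,
    Set.inter_eq_left.2 fun t (ht : t ∈ Set.Icc 1 2) => Set.mem_Ioi.2 (one_pos.trans_le ht.1)]
  calc 0 < ∫⁻ t in Set.Icc (1 : ℝ) 2, ENNReal.ofReal (Real.exp (-2)) := by
        simp [Real.exp_pos]
    _ ≤ _ := setLIntegral_mono (by fun_prop) fun t ht =>
        ENNReal.ofReal_le_ofReal (Real.exp_le_exp.2 (neg_le_neg ht.2))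

/-! ### The quadratic form and Gaussian densities -/

section

variable {q : ℕ} {m : EuclideanSpace ℝ (Fin q)} {Γ : Matrix (Fin q) (Fin q) ℝ}

theorem continuous_quadForm : Continuous (quadForm m Γ) := by
  unfold quadForm dotProduct Matrix.mulVec dotProduct
  fun_prop

theorem quadForm_nonneg (hΓ : Γ.PosDef) (x : EuclideanSpace ℝ (Fin q)) : 0 ≤ quadForm m Γ x := by
  have h := hΓ.inv.posSemidef.dotProduct_mulVec_nonneg (WithLp.ofLp (x - m))
  rwa [star_trivial] at h

theorem quadForm_pos (hΓ : Γ.PosDef) {x : EuclideanSpace ℝ (Fin q)} (hx : x ≠ m) :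
    0 < quadForm m Γ x := by
  have : WithLp.ofLp (x - m) ≠ 0 := fun h => hx (sub_eq_zero.1 (by ext i; exact congrFun h i))
  have h := hΓ.inv.dotProduct_mulVec_pos this
  rwa [star_trivial] at h

/-- Whitening: with `Γ⁻¹ = Bᴴ B`, the substitution `z = B (x - m)` turns the quadratic form into the
squared norm and has Jacobian `1 / √(det Γ)`. -/
theorem lintegral_comp_quadForm (hΓ : Γ.PosDef) {F : ℝ → ℝ≥0∞} (hF : Measurable F) :
    ∫⁻ x, F (quadForm m Γ x) =
      ENNReal.ofReal √Γ.det * ∫⁻ z : EuclideanSpace ℝ (Fin q), F (‖z‖ ^ 2) := by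
  obtain ⟨B, hB, hBB⟩ : ∃ B, IsUnit B ∧ Γ⁻¹ = Bᴴ * B := by
    open scoped MatrixOrder Matrix.Norms.L2Operator in
    exact CStarAlgebra.isStrictlyPositive_iff_eq_star_mul_self.1 hΓ.inv.isStrictlyPositive
  set L : EuclideanSpace ℝ (Fin q) →ₗ[ℝ] EuclideanSpace ℝ (Fin q) := Matrix.toEuclideanLin B with hL
  have hdet : LinearMap.det L = B.det := by
    rw [hL, Matrix.toEuclideanLin_eq_toLin_orthonormal, LinearMap.det_toLin]
  have hBdet : B.det ≠ 0 := ((Matrix.isUnit_iff_isUnit_det B).1 hB).ne_zero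
  have hsq : |(B.det)⁻¹| = √Γ.det := by
    have h := congrArg Matrix.det hBB
    rw [Matrix.det_nonsing_inv, Matrix.det_mul, Matrix.det_conjTranspose, star_trivial,
      Ring.inverse_eq_inv'] at h
    rw [← Real.sqrt_sq_eq_abs, inv_pow, sq, ← h, inv_inv]
  have hq : ∀ x, quadForm m Γ x = ‖L (x - m)‖ ^ 2 := by
    intro x
    rw [EuclideanSpace.real_norm_sq_eq, quadForm, hBB, Matrix.conjTranspose_eq_transpose_of_trivial,
      ← Matrix.mulVec_mulVec, Matrix.dotProduct_mulVec, Matrix.vecMul_transpose]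
    simp [dotProduct, hL, sq, Matrix.toLpLin_apply]
  have hLm : Measurable L := L.continuous_of_finiteDimensional.measurable
  have hFm : Measurable fun z : EuclideanSpace ℝ (Fin q) => F (‖z‖ ^ 2) := by fun_prop
  simp only [hq]
  rw [lintegral_sub_right_eq_self (μ := volume) (fun x => F (‖L x‖ ^ 2)) m,
    ← lintegral_map hFm hLm,
    Measure.map_linearMap_addHaar_eq_smul_addHaar _ (hdet ▸ hBdet), hdet, hsq,
    lintegral_smul_measure, smul_eq_mul]

/-- The density of the centred Gaussian law with covariance `lam t Γ`, as a function of the value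
`y` of the quadratic form; `d` stands for `det Γ`. -/
noncomputable def gaussProfile (q : ℕ) (lam d t y : ℝ) : ℝ :=
  (√d)⁻¹ * ((2 * Real.pi * lam * t) ^ (-((q : ℝ) / 2)) * Real.exp (-(y / (2 * lam * t))))

variable {lam : ℝ}

theorem measurable_gaussProfile (d : ℝ) :
    Measurable fun z : ℝ × ℝ => gaussProfile q lam d z.1 z.2 := by
  unfold gaussProfile
  fun_prop

theorem gaussProfile_nonneg (hlam : 0 < lam) (d : ℝ) {t : ℝ} (ht : 0 < t) (y : ℝ) :
    0 ≤ gaussProfile q lam d t y := by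
  have := Real.pi_pos
  unfold gaussProfile
  positivity

theorem lintegral_gaussProfile (hlam : 0 < lam) (hΓ : Γ.PosDef) {t : ℝ} (ht : 0 < t) :
    ∫⁻ x, ENNReal.ofReal (gaussProfile q lam Γ.det t (quadForm m Γ x)) = 1 := by
  have hpi := Real.pi_pos
  have hd : 0 < √Γ.det := Real.sqrt_pos.2 hΓ.det_pos
  have hb : 0 < 1 / (2 * lam * t) := by positivity
  have hI := GaussianFourier.integral_rexp_neg_mul_sq_norm (V := EuclideanSpace ℝ (Fin q)) hb
  rw [finrank_euclideanSpace, Fintype.card_fin,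
    show Real.pi / (1 / (2 * lam * t)) = 2 * Real.pi * lam * t by field_simp] at hI
  have hpos : 0 < (2 * Real.pi * lam * t) ^ ((q : ℝ) / 2) := by positivity
  have hint : Integrable fun v : EuclideanSpace ℝ (Fin q) =>
      Real.exp (-(1 / (2 * lam * t)) * ‖v‖ ^ 2) :=
    Integrable.of_integral_ne_zero (hI ▸ hpos.ne')
  rw [lintegral_comp_quadForm (F := fun y => ENNReal.ofReal (gaussProfile q lam Γ.det t y)) hΓ
    (((measurable_gaussProfile Γ.det).comp measurable_prodMk_left).ennreal_ofReal)]
  have : ∀ v : EuclideanSpace ℝ (Fin q),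
      ENNReal.ofReal (gaussProfile q lam Γ.det t (‖v‖ ^ 2)) =
      ENNReal.ofReal ((√Γ.det)⁻¹ * (2 * Real.pi * lam * t) ^ (-((q : ℝ) / 2))) *
        ENNReal.ofReal (Real.exp (-(1 / (2 * lam * t)) * ‖v‖ ^ 2)) := by
    intro v
    rw [← ENNReal.ofReal_mul (by positivity), gaussProfile, ← mul_assoc,
      show -(‖v‖ ^ 2 / (2 * lam * t)) = -(1 / (2 * lam * t)) * ‖v‖ ^ 2 by ring]
  simp only [this]
  rw [lintegral_const_mul _ (by fun_prop), ← ofReal_integral_eq_lintegral_ofReal hint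
    (ae_of_all _ fun x => (Real.exp_pos _).le), hI, ← ENNReal.ofReal_mul (by positivity),
    ← ENNReal.ofReal_mul (by positivity), Real.rpow_neg (by positivity), ← ENNReal.ofReal_one]
  congr 1
  field_simp

/-- Integration against the Gaussian scale mixture, in either order. -/
theorem lintegral_mul_gaussProfile_swap {H : ℝ × ℝ → ℝ≥0∞} (hH : Measurable H) :
    ∫⁻ x, ∫⁻ t, H (t, quadForm m Γ x) ∂expLaw = ∫⁻ t, (∫⁻ x, H (t, quadForm m Γ x)) ∂expLaw :=
  lintegral_lintegral_swap (hH.comp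
    (measurable_snd.prodMk (continuous_quadForm.measurable.comp measurable_fst))).aemeasurable

/-! ### The multivariate Laplacian density as a Gaussian scale mixture -/

theorem measurable_besselK (ν : ℝ) : Measurable (besselK ν) := by
  unfold besselK
  refine Measurable.mul (by fun_prop) (StronglyMeasurable.integral_prod_right ?_).measurable
  exact Measurable.stronglyMeasurable (by unfold Function.uncurry; fun_prop)

theorem measurable_mvLaplacePDF : Measurable (mvLaplacePDF m lam Γ) := by
  have hq : Measurable (quadForm m Γ) := continuous_quadForm.measurable
  unfold mvLaplacePDF
  exact (((measurable_besselK _).comp (hq.const_mul _).sqrt).div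
    ((hq.const_mul _).sqrt.pow_const _)).const_mul _

theorem mvLaplacePDF_nonneg (hlam : 0 < lam) (x : EuclideanSpace ℝ (Fin q)) :
    0 ≤ mvLaplacePDF m lam Γ x := by
  have hpi := Real.pi_pos
  unfold mvLaplacePDF besselK
  have : 0 ≤ ∫ t in Set.Ioi (0 : ℝ),
      Real.exp (-t - √(2 / lam * quadForm m Γ x) ^ 2 / (4 * t)) * t ^ (-((q : ℝ) / 2 - 1) - 1) :=
    setIntegral_nonneg measurableSet_Ioi fun t ht =>
      mul_nonneg (Real.exp_pos _).le (Real.rpow_nonneg (le_of_lt ht) _)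
  positivity

/-- Away from the mean, the integral representation of `K_ν` exhibits the density as an exponential
mixture of Gaussian densities. -/
theorem mvLaplacePDF_eq_integral (hlam : 0 < lam) (hΓ : Γ.PosDef) {x : EuclideanSpace ℝ (Fin q)}
    (hx : x ≠ m) :
    mvLaplacePDF m lam Γ x = ∫ t in Set.Ioi (0 : ℝ),
      Real.exp (-t) * gaussProfile q lam Γ.det t (quadForm m Γ x) := by
  have hpi := Real.pi_pos
  have hd : 0 < √Γ.det := Real.sqrt_pos.2 hΓ.det_pos
  have hy := quadForm_pos (m := m) hΓ hx
  set y := quadForm m Γ x with hydef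
  have hb : 0 < √(lam / 2 * y) := Real.sqrt_pos.2 (by positivity)
  have hab : √(2 / lam * y) = 2 / lam * √(lam / 2 * y) := by
    rw [show 2 / lam * y = (2 / lam) ^ 2 * (lam / 2 * y) by field_simp,
      Real.sqrt_mul (by positivity), Real.sqrt_sq (by positivity)]
  have hsq : √(2 / lam * y) ^ 2 = 2 / lam * y := Real.sq_sqrt (by positivity)
  have hratio : (√(2 / lam * y) / 2) ^ ((q : ℝ) / 2 - 1) / √(lam / 2 * y) ^ ((q : ℝ) / 2 - 1) =
      lam * lam ^ (-((q : ℝ) / 2)) := by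
    rw [← Real.div_rpow (by positivity) (by positivity), hab,
      show 2 / lam * √(lam / 2 * y) / 2 / √(lam / 2 * y) = lam⁻¹ by field_simp,
      Real.inv_rpow hlam.le, ← Real.rpow_neg hlam.le, neg_sub, sub_eq_add_neg,
      Real.rpow_add hlam, Real.rpow_one]
  have hcongr : ∫ t in Set.Ioi (0 : ℝ), Real.exp (-t) * gaussProfile q lam Γ.det t y =
      ∫ t in Set.Ioi (0 : ℝ),
        ((√Γ.det)⁻¹ * ((2 * Real.pi) ^ (-((q : ℝ) / 2)) * lam ^ (-((q : ℝ) / 2)))) *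
        (Real.exp (-t - √(2 / lam * y) ^ 2 / (4 * t)) * t ^ (-((q : ℝ) / 2 - 1) - 1)) := by
    refine setIntegral_congr_fun measurableSet_Ioi fun t ht => ?_
    have ht : 0 < t := ht
    simp only [gaussProfile]
    rw [hsq, sub_eq_add_neg (-t), Real.exp_add, Real.mul_rpow (by positivity) ht.le,
      Real.mul_rpow (by positivity) hlam.le,
      show -((q : ℝ) / 2 - 1) - 1 = -((q : ℝ) / 2) by ring,
      show 2 / lam * y / (4 * t) = y / (2 * lam * t) by field_simp; ring]
    ring
  rw [hcongr, integral_const_mul, mvLaplacePDF, ← hydef, besselK]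
  set I := ∫ t in Set.Ioi (0 : ℝ),
    Real.exp (-t - √(2 / lam * y) ^ 2 / (4 * t)) * t ^ (-((q : ℝ) / 2 - 1) - 1)
  rw [show 1 / 2 * (√(2 / lam * y) / 2) ^ ((q : ℝ) / 2 - 1) * I /
      √(lam / 2 * y) ^ ((q : ℝ) / 2 - 1) = 1 / 2 * ((√(2 / lam * y) / 2) ^ ((q : ℝ) / 2 - 1) /
      √(lam / 2 * y) ^ ((q : ℝ) / 2 - 1)) * I by ring, hratio, Real.rpow_neg hlam.le,
    Real.rpow_neg (by positivity)]
  field_simp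

theorem ae_ne_mean (hq : 0 < q) : ∀ᵐ x : EuclideanSpace ℝ (Fin q), x ≠ m := by
  have : Nonempty (Fin q) := ⟨⟨0, hq⟩⟩
  exact compl_mem_ae_iff.2 (measure_singleton m)

theorem lintegral_gaussProfile_mixture (hlam : 0 < lam) (hΓ : Γ.PosDef) :
    ∫⁻ x, ∫⁻ t, ENNReal.ofReal (gaussProfile q lam Γ.det t (quadForm m Γ x)) ∂expLaw = 1 := by
  rw [lintegral_mul_gaussProfile_swap (H := fun z => ENNReal.ofReal (gaussProfile q lam Γ.det z.1 z.2))
    (measurable_gaussProfile Γ.det).ennreal_ofReal]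
  rw [lintegral_congr_ae (g := fun _ => 1)
    (ae_expLaw_pos.mono fun t ht => lintegral_gaussProfile hlam hΓ ht)]
  simp

theorem measurable_gaussProfile_left (d y : ℝ) : Measurable fun t => gaussProfile q lam d t y :=
  (measurable_gaussProfile d).comp measurable_prodMk_right

/-- Almost everywhere the mixture integral is finite, since its total mass is `1`; there it is the
density. -/
theorem ofReal_mvLaplacePDF (hq : 0 < q) (hlam : 0 < lam) (hΓ : Γ.PosDef) :
    ∀ᵐ x, ENNReal.ofReal (mvLaplacePDF m lam Γ x) =
      ∫⁻ t, ENNReal.ofReal (gaussProfile q lam Γ.det t (quadForm m Γ x)) ∂expLaw := by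
  have hmeas : Measurable fun x =>
      ∫⁻ t, ENNReal.ofReal (gaussProfile q lam Γ.det t (quadForm m Γ x)) ∂expLaw :=
    Measurable.lintegral_prod_right' (f := fun z : EuclideanSpace ℝ (Fin q) × ℝ =>
      ENNReal.ofReal (gaussProfile q lam Γ.det z.2 (quadForm m Γ z.1)))
      ((measurable_gaussProfile Γ.det).comp
        (measurable_snd.prodMk (continuous_quadForm.measurable.comp measurable_fst))).ennreal_ofReal
  have hfin := ae_lt_top hmeas
    (by rw [lintegral_gaussProfile_mixture (m := m) hlam hΓ]; exact ENNReal.one_ne_top)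
  filter_upwards [hfin, ae_ne_mean hq] with x hx hxm
  have hgm := measurable_gaussProfile_left (q := q) (lam := lam) Γ.det (quadForm m Γ x)
  have heq : ∫⁻ t, ENNReal.ofReal (gaussProfile q lam Γ.det t (quadForm m Γ x)) ∂expLaw =
      ∫⁻ t in Set.Ioi 0,
        ENNReal.ofReal (Real.exp (-t) * gaussProfile q lam Γ.det t (quadForm m Γ x)) := by
    rw [lintegral_expLaw hgm.ennreal_ofReal]
    exact lintegral_congr fun t => (ENNReal.ofReal_mul (Real.exp_pos _).le).symm
  rw [mvLaplacePDF_eq_integral hlam hΓ hxm, integral_eq_lintegral_of_nonneg_ae, ← heq,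
    ENNReal.ofReal_toReal hx.ne]
  · filter_upwards [ae_restrict_mem measurableSet_Ioi] with t ht
    exact mul_nonneg (Real.exp_pos _).le (gaussProfile_nonneg hlam _ ht _)
  · exact (Measurable.mul (by fun_prop) hgm).aestronglyMeasurable

theorem lintegral_mvLaplacePDF (hq : 0 < q) (hlam : 0 < lam) (hΓ : Γ.PosDef) :
    ∫⁻ x, ENNReal.ofReal (mvLaplacePDF m lam Γ x) = 1 := by
  rw [lintegral_congr_ae (ofReal_mvLaplacePDF hq hlam hΓ), lintegral_gaussProfile_mixture hlam hΓ]

theorem isProbabilityMeasure_mvLaplace (hq : 0 < q) (hlam : 0 < lam) (hΓ : Γ.PosDef) :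
    IsProbabilityMeasure (mvLaplace m lam Γ) :=
  ⟨by rw [mvLaplace, withDensity_apply _ MeasurableSet.univ, setLIntegral_univ,
    lintegral_mvLaplacePDF hq hlam hΓ]⟩

/-! ### Finiteness of the entropy -/

/-- A Gaussian lower bound for the density, from the scales in `[1, 2]`. -/
theorem exists_le_mvLaplacePDF (hq : 0 < q) (hlam : 0 < lam) (hΓ : Γ.PosDef) :
    ∃ c, 0 < c ∧ ∀ᵐ x, c * Real.exp (-(quadForm m Γ x / (2 * lam))) ≤ mvLaplacePDF m lam Γ x := by
  have hpi := Real.pi_pos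
  have hd : 0 < √Γ.det := Real.sqrt_pos.2 hΓ.det_pos
  set a : ℝ := (√Γ.det)⁻¹ * (2 * Real.pi * lam * 2) ^ (-((q : ℝ) / 2)) with ha
  have hapos : 0 < a := by positivity
  have hne : expLaw (Set.Icc 1 2) ≠ ∞ := measure_ne_top _ _
  refine ⟨a * (expLaw (Set.Icc 1 2)).toReal,
    mul_pos hapos (ENNReal.toReal_pos expLaw_Icc_pos.ne' hne), ?_⟩
  filter_upwards [ofReal_mvLaplacePDF (m := m) hq hlam hΓ] with x hx
  have hy := quadForm_nonneg (m := m) hΓ x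
  set y := quadForm m Γ x
  rw [← ENNReal.ofReal_le_ofReal_iff (mvLaplacePDF_nonneg hlam x), hx]
  calc ENNReal.ofReal (a * (expLaw (Set.Icc 1 2)).toReal * Real.exp (-(y / (2 * lam))))
      = ∫⁻ _ in Set.Icc 1 2, ENNReal.ofReal (a * Real.exp (-(y / (2 * lam)))) ∂expLaw := by
        rw [setLIntegral_const, mul_right_comm, ENNReal.ofReal_mul (by positivity),
          ENNReal.ofReal_toReal hne]
    _ ≤ ∫⁻ t in Set.Icc 1 2, ENNReal.ofReal (gaussProfile q lam Γ.det t y) ∂expLaw := by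
        refine setLIntegral_mono (measurable_gaussProfile_left _ _).ennreal_ofReal fun t ht => ?_
        have ht0 : 0 < t := lt_of_lt_of_le one_pos ht.1
        refine ENNReal.ofReal_le_ofReal ?_
        rw [gaussProfile, ha, mul_assoc]
        gcongr ?_ * (?_ * Real.exp (-?_))
        · exact Real.rpow_le_rpow_of_nonpos (by positivity) (by gcongr; exact ht.2)
            (neg_nonpos.2 (by positivity))
        · exact div_le_div_of_nonneg_left hy (by positivity)
            (le_mul_of_one_le_right (by positivity) ht.1)
    _ ≤ _ := setLIntegral_le_lintegral _ _

/-- Second moments: `y ≤ 4 lam t exp (y / (4 lam t))` trades the factor `y` for a doubled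
variance. -/
theorem lintegral_quadForm_mul_mvLaplacePDF_lt_top (hq : 0 < q) (hlam : 0 < lam) (hΓ : Γ.PosDef) :
    ∫⁻ x, ENNReal.ofReal (mvLaplacePDF m lam Γ x * quadForm m Γ x) < ∞ := by
  have hpi := Real.pi_pos
  have hd : 0 < √Γ.det := Real.sqrt_pos.2 hΓ.det_pos
  have h1 : ∀ᵐ x, ENNReal.ofReal (mvLaplacePDF m lam Γ x * quadForm m Γ x) =
      ∫⁻ t, ENNReal.ofReal (gaussProfile q lam Γ.det t (quadForm m Γ x)) *
        ENNReal.ofReal (quadForm m Γ x) ∂expLaw := by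
    filter_upwards [ofReal_mvLaplacePDF (m := m) hq hlam hΓ] with x hx
    rw [ENNReal.ofReal_mul (mvLaplacePDF_nonneg hlam x), hx,
      lintegral_mul_const _ (measurable_gaussProfile_left _ _).ennreal_ofReal]
  rw [lintegral_congr_ae h1, lintegral_mul_gaussProfile_swap
    (H := fun z => ENNReal.ofReal (gaussProfile q lam Γ.det z.1 z.2) * ENNReal.ofReal z.2)
    ((measurable_gaussProfile Γ.det).ennreal_ofReal.mul (by fun_prop))]
  have hbound : ∀ t, 0 < t → ∀ y, gaussProfile q lam Γ.det t y * y ≤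
      (4 * lam * 2 ^ ((q : ℝ) / 2) * t) * gaussProfile q lam Γ.det (2 * t) y := by
    intro t ht y
    have he : y ≤ 4 * lam * t * Real.exp (y / (4 * lam * t)) := by
      have := Real.add_one_le_exp (y / (4 * lam * t))
      rw [← div_le_iff₀' (by positivity)]
      linarith
    have h2 : Real.exp (-(y / (2 * lam * t))) * Real.exp (y / (4 * lam * t)) =
        Real.exp (-(y / (2 * lam * (2 * t)))) := by
      rw [← Real.exp_add]
      congr 1
      field_simp
      ring
    have h3 : (2 * Real.pi * lam * (2 * t)) ^ (-((q : ℝ) / 2)) =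
        (2 ^ ((q : ℝ) / 2))⁻¹ * (2 * Real.pi * lam * t) ^ (-((q : ℝ) / 2)) := by
      rw [show 2 * Real.pi * lam * (2 * t) = 2 * (2 * Real.pi * lam * t) by ring,
        Real.mul_rpow two_pos.le (by positivity), Real.rpow_neg two_pos.le]
    calc gaussProfile q lam Γ.det t y * y
        ≤ gaussProfile q lam Γ.det t y * (4 * lam * t * Real.exp (y / (4 * lam * t))) :=
          mul_le_mul_of_nonneg_left he (gaussProfile_nonneg hlam _ ht _)
      _ = _ := by
          unfold gaussProfile
          rw [← h2, h3]
          field_simp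
  calc _ ≤ ∫⁻ t, ENNReal.ofReal (4 * lam * 2 ^ ((q : ℝ) / 2)) *
        ENNReal.ofReal (t ^ ((2 : ℝ) - 1)) ∂expLaw := by
        refine lintegral_mono_ae (ae_expLaw_pos.mono fun t ht => ?_)
        calc _ ≤ ∫⁻ x, ENNReal.ofReal (4 * lam * 2 ^ ((q : ℝ) / 2) * t) *
              ENNReal.ofReal (gaussProfile q lam Γ.det (2 * t) (quadForm m Γ x)) := by
              refine lintegral_mono fun x => ?_
              simp only
              rw [← ENNReal.ofReal_mul (gaussProfile_nonneg hlam _ ht _),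
                ← ENNReal.ofReal_mul (by positivity)]
              exact ENNReal.ofReal_le_ofReal (hbound t ht _)
          _ = _ := by
              rw [lintegral_const_mul' _ _ ENNReal.ofReal_ne_top,
                lintegral_gaussProfile hlam hΓ (by positivity), mul_one,
                ENNReal.ofReal_mul (by positivity)]
              norm_num
    _ < ∞ := by
        rw [lintegral_const_mul' _ _ ENNReal.ofReal_ne_top]
        exact ENNReal.mul_lt_top ENNReal.ofReal_lt_top (lintegral_rpow_expLaw_lt_top two_pos)

/-- The density lies in `L^(1 + 1/q)`. By Jensen this reduces to the Gaussian components, and the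
exponent is chosen so that their suprema to the power `1/q` grow only like `t ^ (-1/2)` as
`t → 0`. -/
theorem lintegral_mvLaplacePDF_mul_rpow_lt_top (hq : 0 < q) (hlam : 0 < lam) (hΓ : Γ.PosDef) :
    ∫⁻ x, ENNReal.ofReal (mvLaplacePDF m lam Γ x * mvLaplacePDF m lam Γ x ^ (1 / (q : ℝ))) < ∞ := by
  have hpi := Real.pi_pos
  have hq' : (0 : ℝ) < q := Nat.cast_pos.2 hq
  have hd : 0 < √Γ.det := Real.sqrt_pos.2 hΓ.det_pos
  set r : ℝ := 1 + 1 / (q : ℝ) with hr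
  have hr1 : 1 < r := lt_add_of_pos_right _ (by positivity)
  have hr0 : 0 < r := one_pos.trans hr1
  have hpow : ∀ u : ℝ, 0 ≤ u → ENNReal.ofReal (u * u ^ (1 / (q : ℝ))) = ENNReal.ofReal u ^ r := by
    intro u hu
    rw [ENNReal.ofReal_rpow_of_nonneg hu hr0.le, hr, Real.rpow_add' hu hr0.ne', Real.rpow_one]
  have h1 : ∀ᵐ x, ENNReal.ofReal (mvLaplacePDF m lam Γ x * mvLaplacePDF m lam Γ x ^ (1 / (q : ℝ))) ≤
      ∫⁻ t, ENNReal.ofReal (gaussProfile q lam Γ.det t (quadForm m Γ x)) ^ r ∂expLaw := by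
    filter_upwards [ofReal_mvLaplacePDF (m := m) hq hlam hΓ] with x hx
    rw [hpow _ (mvLaplacePDF_nonneg hlam x), hx, ← ENNReal.le_rpow_inv_iff hr0]
    have := ENNReal.lintegral_mul_le_Lp_mul_Lq expLaw (Real.HolderConjugate.conjExponent hr1)
      (measurable_gaussProfile_left (q := q) (lam := lam) Γ.det
        (quadForm m Γ x)).ennreal_ofReal.aemeasurable
      (aemeasurable_const (b := (1 : ℝ≥0∞)))
    simpa using this
  refine (lintegral_mono_ae h1).trans_lt ?_
  rw [lintegral_mul_gaussProfile_swap
    (H := fun z => ENNReal.ofReal (gaussProfile q lam Γ.det z.1 z.2) ^ r)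
    ((measurable_gaussProfile Γ.det).ennreal_ofReal.pow_const r)]
  set C : ℝ := (√Γ.det)⁻¹ ^ (1 / (q : ℝ)) * (2 * Real.pi * lam) ^ (-(1 / 2 : ℝ)) with hC
  have hbound : ∀ t, 0 < t → ∀ y, 0 ≤ y → gaussProfile q lam Γ.det t y ^ (1 / (q : ℝ)) ≤
      C * t ^ ((1 / 2 : ℝ) - 1) := by
    intro t ht y hy
    have hle : gaussProfile q lam Γ.det t y ≤
        (√Γ.det)⁻¹ * (2 * Real.pi * lam * t) ^ (-((q : ℝ) / 2)) := by
      unfold gaussProfile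
      have : Real.exp (-(y / (2 * lam * t))) ≤ 1 := Real.exp_le_one_iff.2
        (neg_nonpos.2 (by positivity))
      gcongr
      exact mul_le_of_le_one_right (by positivity) this
    refine (Real.rpow_le_rpow (gaussProfile_nonneg hlam _ ht _) hle (by positivity)).trans_eq ?_
    rw [Real.mul_rpow (by positivity) (by positivity), ← Real.rpow_mul (by positivity),
      show -((q : ℝ) / 2) * (1 / (q : ℝ)) = -(1 / 2 : ℝ) by field_simp,
      Real.mul_rpow (by positivity) ht.le, hC,
      show (1 / 2 : ℝ) - 1 = -(1 / 2) by norm_num]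
    ring
  have hCpos : 0 < C := by positivity
  calc _ ≤ ∫⁻ t, ENNReal.ofReal C * ENNReal.ofReal (t ^ ((1 / 2 : ℝ) - 1)) ∂expLaw := by
        refine lintegral_mono_ae (ae_expLaw_pos.mono fun t ht => ?_)
        calc _ ≤ ∫⁻ x, ENNReal.ofReal (C * t ^ ((1 / 2 : ℝ) - 1)) *
              ENNReal.ofReal (gaussProfile q lam Γ.det t (quadForm m Γ x)) := by
              refine lintegral_mono fun x => ?_
              simp only
              have h0 := gaussProfile_nonneg (q := q) hlam Γ.det ht (quadForm m Γ x)
              rw [← hpow _ h0, ← ENNReal.ofReal_mul (by positivity), mul_comm]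
              exact ENNReal.ofReal_le_ofReal
                (mul_le_mul_of_nonneg_right (hbound t ht _ (quadForm_nonneg hΓ x)) h0)
          _ = _ := by
              rw [lintegral_const_mul' _ _ ENNReal.ofReal_ne_top, lintegral_gaussProfile hlam hΓ ht,
                mul_one, ENNReal.ofReal_mul hCpos.le]
    _ < ∞ := by
        rw [lintegral_const_mul' _ _ ENNReal.ofReal_ne_top]
        exact ENNReal.mul_lt_top ENNReal.ofReal_lt_top (lintegral_rpow_expLaw_lt_top one_half_pos)

theorem integrable_of_nonneg_of_lintegral_lt_top {α : Type*} [MeasurableSpace α] {μ : Measure α}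
    {f : α → ℝ} (hf : Measurable f) (h0 : ∀ x, 0 ≤ f x)
    (h : ∫⁻ x, ENNReal.ofReal (f x) ∂μ < ∞) : Integrable f μ :=
  ⟨hf.aestronglyMeasurable, (hasFiniteIntegral_iff_ofReal (ae_of_all _ h0)).2 h⟩

theorem integrable_mvLaplacePDF_mul_logb (hq : 0 < q) (hlam : 0 < lam) (hΓ : Γ.PosDef) :
    Integrable fun x => mvLaplacePDF m lam Γ x * Real.logb 2 (mvLaplacePDF m lam Γ x) := by
  have hq' : (0 : ℝ) < q := Nat.cast_pos.2 hq
  have hm : Measurable (mvLaplacePDF m lam Γ) := measurable_mvLaplacePDF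
  have h0 : ∀ x, 0 ≤ mvLaplacePDF m lam Γ x := fun x => mvLaplacePDF_nonneg hlam x
  have hqm : Measurable (quadForm m Γ) := continuous_quadForm.measurable
  have i1 : Integrable (mvLaplacePDF m lam Γ) :=
    integrable_of_nonneg_of_lintegral_lt_top hm h0
      (by rw [lintegral_mvLaplacePDF hq hlam hΓ]; exact ENNReal.one_lt_top)
  have i2 := integrable_of_nonneg_of_lintegral_lt_top (hm.mul hqm)
    (fun x => mul_nonneg (h0 x) (quadForm_nonneg hΓ x))
    (lintegral_quadForm_mul_mvLaplacePDF_lt_top hq hlam hΓ)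
  have i3 := integrable_of_nonneg_of_lintegral_lt_top (hm.mul (hm.pow_const (1 / (q : ℝ))))
    (fun x => mul_nonneg (h0 x) (Real.rpow_nonneg (h0 x) _))
    (lintegral_mvLaplacePDF_mul_rpow_lt_top hq hlam hΓ)
  obtain ⟨c, hc, hlow⟩ := exists_le_mvLaplacePDF (m := m) hq hlam hΓ
  have key : Integrable fun x => mvLaplacePDF m lam Γ x * Real.log (mvLaplacePDF m lam Γ x) := by
    refine Integrable.mono' (((i1.mul_const |Real.log c|).add (i2.mul_const (1 / (2 * lam)))).add
      (i3.mul_const (q : ℝ))) (hm.mul hm.log).aestronglyMeasurable ?_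
    filter_upwards [hlow] with x hx
    have hy := quadForm_nonneg (m := m) hΓ x
    have hpos : 0 < mvLaplacePDF m lam Γ x := lt_of_lt_of_le (by positivity) hx
    have hlo := Real.log_le_log (by positivity) hx
    rw [Real.log_mul hc.ne' (Real.exp_pos _).ne', Real.log_exp] at hlo
    have hup := Real.log_le_rpow_div hpos.le (one_div_pos.2 hq')
    rw [div_div_eq_mul_div, div_one] at hup
    have hrp : 0 ≤ mvLaplacePDF m lam Γ x ^ (1 / (q : ℝ)) * q := by positivity
    have hdiv : 0 ≤ quadForm m Γ x / (2 * lam) := by positivity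
    have habs : |Real.log (mvLaplacePDF m lam Γ x)| ≤ |Real.log c| +
        quadForm m Γ x / (2 * lam) + mvLaplacePDF m lam Γ x ^ (1 / (q : ℝ)) * q := by
      have h1 := neg_abs_le (Real.log c)
      have h2 := abs_nonneg (Real.log c)
      exact abs_le.2 ⟨by linarith, by linarith⟩
    rw [Real.norm_eq_abs, abs_mul, abs_of_pos hpos]
    refine (mul_le_mul_of_nonneg_left habs hpos.le).trans_eq ?_
    simp only [Pi.add_apply, Pi.mul_apply]
    ring
  refine (key.mul_const (Real.log 2)⁻¹).congr (ae_of_all _ fun x => ?_)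
  simp only [Real.logb]
  ring

end

/-! ### Passing from rates to distortions -/

/-- The explicit distortion bound inverts the explicit rate bound. -/
theorem distortionLowerBound_le {q s : ℕ} (hqs : 0 < q + s) {b h ρ ρ' D : ℝ} (hD : 0 < D)
    (hR : rateLowerBound (q + s) h D ≤ (ρ * q + ρ' * s) * b) :
    distortionLowerBound q s b h ρ ρ' ≤ D := by
  have hn : (0 : ℝ) < (q : ℝ) + s := by exact_mod_cast hqs
  have hpi := Real.pi_pos
  have hl : 0 < Real.log 2 := Real.log_pos one_lt_two
  have hG1 := Real.Gamma_pos_of_pos hn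
  have hG2 := Real.Gamma_pos_of_pos (half_pos hn)
  unfold rateLowerBound at hR
  unfold distortionLowerBound
  push_cast at hR
  set n := (q : ℝ) + s
  set R := (ρ * q + ρ' * s) * b
  set G := Real.Gamma (n / 2) / (2 * Real.Gamma n) with hG
  have hGpos : 0 < G := by positivity
  rw [Real.logb, Real.logb, ← div_div n, Real.log_div (x := n / (√Real.pi * Real.exp 1))
    (by positivity) hD.ne'] at hR
  have hR' : h * Real.log 2 + n * (Real.log (n / (√Real.pi * Real.exp 1)) - Real.log D) +
      Real.log G ≤ R * Real.log 2 := by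
    have := mul_le_mul_of_nonneg_right hR hl.le
    refine le_of_eq_of_le ?_ this
    field_simp
  rw [← Real.log_le_log_iff (by positivity) hD, Real.log_mul (by positivity) (by positivity),
    Real.log_mul (by positivity) (by positivity), Real.log_rpow two_pos, Real.log_rpow hGpos]
  refine le_of_mul_le_mul_left ?_ hn
  have : n * (Real.log (n / (√Real.pi * Real.exp 1)) + -((R - h) / n) * Real.log 2 +
      1 / n * Real.log G) = n * Real.log (n / (√Real.pi * Real.exp 1)) - (R - h) * Real.log 2 +
      Real.log G := by
    field_simp
    ring
  rw [this]
  linarith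

theorem Achievable.mono {q : ℕ} {P : Measure (EuclideanSpace ℝ (Fin q))} {R : ℝ} {D D' : ℝ≥0∞}
    (h : Achievable P R D) (hD : D ≤ D') : Achievable P R D' := by
  obtain ⟨M, e, g, he, hM, hlim⟩ := h
  exact ⟨M, e, g, he, hM, hlim.trans hD⟩

theorem rateDistortion_anti {q : ℕ} (P : Measure (EuclideanSpace ℝ (Fin q))) {D D' : ℝ≥0∞}
    (hD : D ≤ D') : rateDistortion P D' ≤ rateDistortion P D :=
  le_iInf fun κ => le_iInf fun hκ => le_iInf fun hd =>
    iInf_le_of_le κ (iInf_le_of_le hκ (iInf_le _ (hd.trans hD)))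

/-- A lower bound for the positive finite members of an upward closed set of distortions bounds its
infimum; the distortions `0` and `∞` need no separate treatment. -/
theorem ofReal_le_sInf_of_upwardClosed {S : ℝ≥0∞ → Prop} (hS : ∀ D D', D ≤ D' → S D → S D')
    {d : ℝ} (h : ∀ D : ℝ, 0 < D → S (ENNReal.ofReal D) → d ≤ D) :
    ENNReal.ofReal d ≤ sInf {D | S D} := by
  refine le_sInf fun D hD => le_of_forall_gt_imp_ge_of_dense fun a ha => ?_
  rcases eq_or_ne a ∞ with rfl | hat
  · exact le_top
  rw [← ENNReal.ofReal_toReal hat]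
  refine ENNReal.ofReal_le_ofReal (h _ (ENNReal.toReal_pos (bot_lt_of_lt ha).ne' hat) ?_)
  rw [ENNReal.ofReal_toReal hat]
  exact hS D a ha.le hD

end RateDist

theorem theorem2 :
    -- the source is well defined with finite entropy, and its rate-distortion function is bounded
    (∀ (q : ℕ) (m : EuclideanSpace ℝ (Fin q)) (lam : ℝ) (Γ : Matrix (Fin q) (Fin q) ℝ),
      0 < q → 0 < lam → Γ.PosDef →
      IsProbabilityMeasure (RateDist.mvLaplace m lam Γ) ∧
      Integrable (fun x => RateDist.mvLaplacePDF m lam Γ x *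
        Real.logb 2 (RateDist.mvLaplacePDF m lam Γ x)) ∧
      ∀ D : ℝ, 0 < D →
        ((RateDist.rateLowerBound q
            (RateDist.differentialEntropy (RateDist.mvLaplacePDF m lam Γ)) D : ℝ) : EReal)
          ≤ (RateDist.rateDistortion (RateDist.mvLaplace m lam Γ) (ENNReal.ofReal D) : EReal) ∧
        ((RateDist.rateLowerBound q
            (RateDist.differentialEntropy (RateDist.mvLaplacePDF m lam Γ)) D : ℝ) : EReal)
          ≤ RateDist.codingRate (RateDist.mvLaplace m lam Γ) (ENNReal.ofReal D)) ∧
    -- the distortion-rate function of the split and pruned model is bounded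
    (∀ (q s : ℕ) (m : EuclideanSpace ℝ (Fin (q + s))) (lam : ℝ)
      (Γ : Matrix (Fin (q + s)) (Fin (q + s)) ℝ) (b ρ ρ' : ℝ),
      0 < q + s → 0 < lam → Γ.PosDef → 0 ≤ b → 0 ≤ ρ → ρ ≤ 1 → 0 ≤ ρ' → ρ' ≤ 1 →
        ENNReal.ofReal (RateDist.distortionLowerBound q s b
            (RateDist.differentialEntropy (RateDist.mvLaplacePDF m lam Γ)) ρ ρ')
          ≤ RateDist.distortionRate (RateDist.mvLaplace m lam Γ) ((ρ * q + ρ' * s) * b) ∧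
        ENNReal.ofReal (RateDist.distortionLowerBound q s b
            (RateDist.differentialEntropy (RateDist.mvLaplacePDF m lam Γ)) ρ ρ')
          ≤ RateDist.rateDistortionInv (RateDist.mvLaplace m lam Γ) ((ρ * q + ρ' * s) * b)) := by
  refine ⟨fun q m lam Γ hq hlam hΓ => ?_, fun q s m lam Γ b ρ ρ' hqs hlam hΓ hb hρ _ hρ' _ => ?_⟩
  · have hprob := RateDist.isProbabilityMeasure_mvLaplace (m := m) hq hlam hΓ
    have hint := RateDist.integrable_mvLaplacePDF_mul_logb (m := m) hq hlam hΓ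
    have hp : Measurable (RateDist.mvLaplacePDF m lam Γ) := RateDist.measurable_mvLaplacePDF
    have hp0 := RateDist.mvLaplacePDF_nonneg (m := m) (Γ := Γ) hlam
    refine ⟨hprob, hint, fun D hD => ?_⟩
    unfold RateDist.mvLaplace at hprob ⊢
    constructor
    · have h := RateDist.rateLowerBound_le_rateDistortion hq hp hp0 hint hD
      refine le_trans ?_ (EReal.coe_ennreal_le_coe_ennreal_iff.2 h)
      rw [EReal.coe_ennreal_ofReal]
      exact EReal.coe_le_coe_iff.2 (le_max_left _ _)
    · exact le_iInf fun R => le_iInf fun h => EReal.coe_le_coe_iff.2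
        (RateDist.rateLowerBound_le_of_achievable hq hp hp0 hint hD h)
  · have hprob := RateDist.isProbabilityMeasure_mvLaplace (m := m) hqs hlam hΓ
    have hint := RateDist.integrable_mvLaplacePDF_mul_logb (m := m) hqs hlam hΓ
    have hp : Measurable (RateDist.mvLaplacePDF m lam Γ) := RateDist.measurable_mvLaplacePDF
    have hp0 := RateDist.mvLaplacePDF_nonneg (m := m) (Γ := Γ) hlam
    unfold RateDist.mvLaplace at hprob ⊢
    constructor
    · exact RateDist.ofReal_le_sInf_of_upwardClosed (fun D D' hD h => h.mono hD) fun D hD h =>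
        RateDist.distortionLowerBound_le hqs hD
          (RateDist.rateLowerBound_le_of_achievable hqs hp hp0 hint hD h)
    · have hR : 0 ≤ (ρ * q + ρ' * s) * b := by positivity
      exact RateDist.ofReal_le_sInf_of_upwardClosed
        (fun D D' hD h => (RateDist.rateDistortion_anti _ hD).trans h) fun D hD h =>
        RateDist.distortionLowerBound_le hqs hD ((ENNReal.ofReal_le_ofReal_iff hR).1
          ((RateDist.rateLowerBound_le_rateDistortion hqs hp hp0 hint hD).trans h))
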